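/- Let $d\ge 1$, let $|\cdot|$ be a norm on $\mathbb R^d$ and $\|\cdot\|$ the induced operator norm, and let $\mathbb Z^+=\{0,1,2,\dots\}$. Let $A:\mathbb Z^+\to\mathcal M_{d\times d}(\mathbb R)$ and $f:\mathbb Z^+\times\mathbb R^d\to\mathbb R^d$, and consider the systems $$x(k+1)=A(k)x(k),\qquad(1)\qquad\qquad y(k+1)=A(k)y(k)+f(k,y(k)).\qquad(2)$$ For invertible $A(k)$ let $\Phi(k,n)=A(k-1)\cdots A(n)$ for $k>n$, $\Phi(n,n)=I$ and $\Phi(k,n)=A(k)^{-1}\cdots A(n-1)^{-1}$ for $k<n$. Assume: - **(d0)** every $A(k)$ is invertible and $\max\{\sup_k\|A(k)\|,\sup_k\|A(k)^{-1}\|\}=M$ for some $M\in(1,\infty)$. - **(d1)** There are projectors $P(n),Q(n)$ with $P(n)+Q(n)=I$, $P(k)\Phi(k,n)=\Phi(k,n)P(n)$ and $Q(k)\Phi(k,n)=\Phi(k,n)Q(n)$ for all $k,n\in\mathbb Z^+$, a nonnegative sequence $D$, and a decreasing sequence $h$ of positive numbers with $h(0)=1$ and $h(n)\to0$, such that $\|\Phi(k,n)P(n)\|\le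 D(n)\,h(k)/h(n)$ for $k\ge n\ge 0$ and $\|\Phi(k,n)Q(n)\|\le D(n)\,h(n)/h(k)$ for $0\le k\le n$. Put $\mathcal G(k,n)=\Phi(k,n)P(n)$ for $k\ge n$ and $\mathcal G(k,n)=-\Phi(k,n)Q(n)$ for $k<n$. - **(d2)** There are nonnegative sequences $\mu,\gamma$ with $|f(k,y)-f(k,\tilde y)|\le\gamma(k)|y-\tilde y|$ and $|f(k,y)|\le\mu(k)$ for all $k,y,\tilde y$. - **(d3)** There is $p<\infty$ with $\sum_{j=0}^\infty\|\mathcal G(k,j+1)\|\mu(j)\le p$ for every $k$. - **(d4)** There is $q<1$ with $\sum_{j=0}^\infty\|\mathcal G(k,j+1)\|\gamma(j)\le q$ for every $k$. - **(d5)** $\|A(\ell)^{-1}\gamma(\ell)\|<1$ for every $\ell$. - **(d6)**, with $r=1$: for each $k$ the map $u\mapsto f(k,u)$ is $C^1$ and $\sup_{u}\|\tfrac{\partial f}{\partial u}(k,u)\|<\infty$. - **(d7)** For each $m\in\mathbb Z^+$, $\displaystyle\sum_{j=m}^\infty D(j+1)h(j+1)\gamma(j)\prod_{p=m}^{j-1}\bigl(\|A(p)\|+\gamma(p)\bigr)<\infty$.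 Then (1) and (2) are $C^1$-topologically equivalent on $\mathbb Z^+$, through Palmer's homeomorphism. Explicitly: through each $(m,\eta)\in\mathbb Z^+\times\mathbb R^d$ there passes a unique solution $y(\cdot,m,\eta)$ of (2) on $\mathbb Z^+$; for each $(m,\xi)$ there is a unique bounded sequence $z^*(\cdot;(m,\xi))$ with $$z^*(k;(m,\xi))=\sum_{j=0}^\infty\mathcal G(k,j+1)f\bigl(j,\Phi(j,m)\xi+z^*(j;(m,\xi))\bigr)\quad(k\in\mathbb Z^+);$$ and the maps $$H(m,\xi)=\xi+z^*(m;(m,\xi)),\qquad G(m,\eta)=\eta-\sum_{j=0}^\infty\mathcal G(m,j+1)f\bigl(j,y(j,m,\eta)\bigr)$$ (with convergent series) have the following properties. For each $k$, $H(k,\cdot)$ and $G(k,\cdot)$ are mutually inverse $C^1$ diffeomorphisms of $\mathbb R^d$; $H(k,u)-u$ and $G(k,u)-u$ are bounded on $\mathbb Z^+\times\mathbb R^d$; if $x$ solves (1) then $k\mapsto H(k,x(k))$ solves (2); and if $y$ solves (2) then $k\mapsto G(k,y(k))$ solves (1). -/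

import Mathlib

namespace DiscretePalmer

variable {E : Type*} [NormedAddCommGroup E] [NormedSpace ℝ E]

/-! Here `E` plays the role of `ℝ^d` with an arbitrary norm, matrices are (continuous) linear maps
`E →L[ℝ] E` with the induced operator norm, and the time set is `ℕ = {0, 1, 2, …}`. -/

/-- `y` solves `y (k + 1) = A k y(k) + f (k, y(k))` on the time set `{0, 1, 2, …}`. -/
def IsSolution (A : ℕ → E →L[ℝ] E) (f : ℕ → E → E) (y : ℕ → E) : Prop :=
  ∀ k, y (k + 1) = A k (y k) + f k (y k)

/-- `x` solves the linear system `x (k + 1) = A k x(k)`. -/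
def IsLinearSolution (A : ℕ → E →L[ℝ] E) (x : ℕ → E) : Prop :=
  ∀ k, x (k + 1) = A k (x k)

/-- `forward A n i = A (n + i - 1) ⋯ A (n + 1) A n`, a product of `i` factors. -/
def forward (A : ℕ → E →L[ℝ] E) (n : ℕ) : ℕ → E →L[ℝ] E
  | 0 => ContinuousLinearMap.id ℝ E
  | i + 1 => (A (n + i)).comp (forward A n i)

/-- `backward A k i = (A k)⁻¹ (A (k + 1))⁻¹ ⋯ (A (k + i - 1))⁻¹`, a product of `i` factors. -/
noncomputable def backward (A : ℕ → E →L[ℝ] E) (k : ℕ) : ℕ → E →L[ℝ] E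
  | 0 => ContinuousLinearMap.id ℝ E
  | i + 1 => (backward A k i).comp (A (k + i)).inverse

/-- The transition matrix `Φ(k, n)` of the linear system. -/
noncomputable def transition (A : ℕ → E →L[ℝ] E) (k n : ℕ) : E →L[ℝ] E :=
  if n ≤ k then forward A n (k - n) else backward A k (n - k)

/-- Green's operator of a dichotomy with projectors `P`, `Q`:
`Φ(k, n) P(n)` for `k ≥ n` and `-Φ(k, n) Q(n)` for `k < n`. -/
noncomputable def green (A P Q : ℕ → E →L[ℝ] E) (k n : ℕ) : E →L[ℝ] E :=
  if n ≤ k then (transition A k n).comp (P n) else -((transition A k n).comp (Q n))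

/-- `A` has invertible values and `max {sup ‖A k‖, sup ‖(A k)⁻¹‖} = M` for some (finite) `M > 1`. -/
def InvertibleBounded (A : ℕ → E →L[ℝ] E) : Prop :=
  (∀ k, (A k).IsInvertible) ∧
  BddAbove (Set.range fun k => ‖A k‖) ∧ BddAbove (Set.range fun k => ‖(A k).inverse‖) ∧
  ∃ M : ℝ, 1 < M ∧ max (⨆ k, ‖A k‖) (⨆ k, ‖(A k).inverse‖) = M

/-- The linear system has a nonuniform dichotomy with complementary invariant projectors `P`, `Q`,
nonnegative sequence `D` and rate `h`, where `h` decreases to zero and `h 0 = 1`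
(it is positive, since one divides by its values). -/
structure IsNonuniformDichotomy (A P Q : ℕ → E →L[ℝ] E) (D h : ℕ → ℝ) : Prop where
  projP : ∀ n, (P n).comp (P n) = P n
  projQ : ∀ n, (Q n).comp (Q n) = Q n
  complementary : ∀ n, P n + Q n = ContinuousLinearMap.id ℝ E
  invariantP : ∀ k n, (P k).comp (transition A k n) = (transition A k n).comp (P n)
  invariantQ : ∀ k n, (Q k).comp (transition A k n) = (transition A k n).comp (Q n)
  D_nonneg : ∀ n, 0 ≤ D n
  h_pos : ∀ n, 0 < h n
  h_antitone : Antitone h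
  h_tendsto : Filter.Tendsto h Filter.atTop (nhds 0)
  h_zero : h 0 = 1
  stable : ∀ k n, n ≤ k → ‖(transition A k n).comp (P n)‖ ≤ D n * (h k / h n)
  unstable : ∀ k n, k ≤ n → ‖(transition A k n).comp (Q n)‖ ≤ D n * (h n / h k)

/-- `f k` is `γ k`-Lipschitz and bounded by `μ k`, with `γ k, μ k ≥ 0`. -/
def LipschitzAndBounded (f : ℕ → E → E) (μ γ : ℕ → ℝ) : Prop :=
  (∀ k, 0 ≤ μ k) ∧ (∀ k, 0 ≤ γ k) ∧
  (∀ k y y', ‖f k y - f k y'‖ ≤ γ k * ‖y - y'‖) ∧ ∀ k y, ‖f k y‖ ≤ μ k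

/-- `∑_{j ≥ 0} ‖𝒢(k, j + 1)‖ a(j)` converges and is at most `c`, for every `k`. -/
def GreenSumLE (A P Q : ℕ → E →L[ℝ] E) (a : ℕ → ℝ) (c : ℝ) : Prop :=
  ∀ k, Summable (fun j => ‖green A P Q k (j + 1)‖ * a j) ∧
    ∑' j, ‖green A P Q k (j + 1)‖ * a j ≤ c

/-- `‖A(ℓ)⁻¹ γ(ℓ)‖ < 1` for all `ℓ`. -/
def BackwardContinuable (A : ℕ → E →L[ℝ] E) (γ : ℕ → ℝ) : Prop :=
  ∀ l, ‖γ l • (A l).inverse‖ < 1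

/-- Each `f k` is of class `C^r` and its first derivative is bounded. (Since the time set is
discrete, joint continuity in `(k, u)` is continuity in `u` for each `k`.) -/
def SmoothPerturbation (f : ℕ → E → E) (r : ℕ) : Prop :=
  ∀ k, ContDiff ℝ r (f k) ∧ BddAbove (Set.range fun u => ‖fderiv ℝ (f k) u‖)

/-- For each `m`, the series
`∑_{j ≥ m} D(j+1) h(j+1) γ(j) ∏_{p=m}^{j-1} (‖A(p)‖ + γ(p))`, written with `j = m + i`,
converges. -/
def WeightedSummable (A : ℕ → E →L[ℝ] E) (D h γ : ℕ → ℝ) : Prop :=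
  ∀ m, Summable fun i : ℕ =>
    D (m + i + 1) * h (m + i + 1) * γ (m + i) * ∏ p ∈ Finset.Ico m (m + i), (‖A p‖ + γ p)

/-- `H` is a topological equivalence on `{0, 1, 2, …}` from the linear system to the perturbed
one, with fibrewise inverse `G`. -/
structure IsTopologicalEquivalence (A : ℕ → E →L[ℝ] E) (f H G : ℕ → E → E) : Prop where
  left_inv : ∀ k, Function.LeftInverse (G k) (H k)
  right_inv : ∀ k, Function.RightInverse (G k) (H k)
  continuous_H : ∀ k, Continuous (H k)
  continuous_G : ∀ k, Continuous (G k)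
  maps_H : ∀ x, IsLinearSolution A x → IsSolution A f fun k => H k (x k)
  maps_G : ∀ y, IsSolution A f y → IsLinearSolution A fun k => G k (y k)
  bounded_H : ∃ C : ℝ, ∀ k u, ‖H k u - u‖ ≤ C
  bounded_G : ∃ C : ℝ, ∀ k u, ‖G k u - u‖ ≤ C

/-- A topological equivalence such that each `H k` is a diffeomorphism of class `C^r`
(with inverse `G k`). -/
structure IsTopologicalEquivalenceOfClass (r : ℕ) (A : ℕ → E →L[ℝ] E) (f H G : ℕ → E → E) : Prop
    extends IsTopologicalEquivalence A f H G where
  contDiff_H : ∀ k, ContDiff ℝ r (H k)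
  contDiff_G : ∀ k, ContDiff ℝ r (G k)

/-- `z` is a bounded sequence with `z(k) = ∑_{j ≥ 0} 𝒢(k, j+1) f(j, x(j) + z(j))` for all `k`,
where `x(j) = Φ(j, m) ξ`. -/
def IsPalmerFixedPoint (A P Q : ℕ → E →L[ℝ] E) (f : ℕ → E → E) (m : ℕ) (ξ : E) (z : ℕ → E) :
    Prop :=
  (∃ C : ℝ, ∀ k, ‖z k‖ ≤ C) ∧
  ∀ k, HasSum (fun j => green A P Q k (j + 1) (f j (transition A j m ξ + z j))) (z k)

/-- `H` is Palmer's map: `H(m, ξ) = ξ + z(m)`, where `z` is the unique bounded solution of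
`z(k) = ∑_{j ≥ 0} 𝒢(k, j+1) f(j, Φ(j, m) ξ + z(j))`. -/
def IsPalmerMap (A P Q : ℕ → E →L[ℝ] E) (f H : ℕ → E → E) : Prop :=
  ∀ m ξ, ∃ z : ℕ → E, IsPalmerFixedPoint A P Q f m ξ z ∧
    (∀ z', IsPalmerFixedPoint A P Q f m ξ z' → z' = z) ∧ H m ξ = ξ + z m

/-- `G` is Palmer's inverse map: `G(m, η) = η - ∑_{j ≥ 0} 𝒢(m, j+1) f(j, y(j))`, where `y` is the
unique solution of the perturbed system with `y(m) = η`. -/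
def IsPalmerInverse (A P Q : ℕ → E →L[ℝ] E) (f G : ℕ → E → E) : Prop :=
  ∀ m η, ∃ y : ℕ → E, (IsSolution A f y ∧ y m = η) ∧
    (∀ y', IsSolution A f y' ∧ y' m = η → y' = y) ∧
    HasSum (fun j => green A P Q m (j + 1) (f j (y j))) (η - G m η)

end DiscretePalmer

/-! Everything is reduced to time `0`. The perturbed flow `Y k` from time `0` is a `C¹`
diffeomorphism, and conjugating by `Y k` and the transition matrices carries maps `H0`, `G0` at time
`0` to `H k`, `G k`. That `H0` and `G0` are mutually inverse is Palmer's classical argument: Green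
sums solve the inhomogeneous equation (`hasSum_green_succ`), and bounded fixed points are unique
because `q < 1`.

For smoothness, `G0` is an explicit series whose termwise derivative is dominated by the weighted
series of (d7) (`contDiff_palmerInverseZero`). `H0` is then `C¹` by the inverse function theorem
once `DG0(η)` is injective. If `DG0(η) v = 0`, then `u j = DY_j(η) v` solves the variational
equation and equals its own Green sum, the sum at time `0` propagating to all times. A bounded such
`u` vanishes by contraction, so boundedness is the crux (`eq_zero_of_hasSum_green_zero`). The Green
sum at time `k` is split at `j = k`: the past contributes at most `q` times the maximum of the
earlier norms, the future at most a tail of the weighted series times `‖u k‖`. For large `k` the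
latter is absorbed. -/

namespace DiscretePalmer

variable {E : Type*} [NormedAddCommGroup E] [NormedSpace ℝ E]

/-! ### Inverse function theorem for global bijections. -/

section Calculus

/-- A linear endomorphism of a finite-dimensional space with trivial kernel, as a continuous
linear equivalence. -/
theorem exists_equiv_of_ker_trivial [FiniteDimensional ℝ E] (L : E →L[ℝ] E)
    (hL : ∀ v, L v = 0 → v = 0) : ∃ e : E ≃L[ℝ] E, (e : E →L[ℝ] E) = L := by
  have hinj : Function.Injective (L : E →ₗ[ℝ] E) :=
    (injective_iff_map_eq_zero (L : E →ₗ[ℝ] E)).2 hL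
  refine ⟨(LinearEquiv.ofInjectiveEndo (L : E →ₗ[ℝ] E) hinj).toContinuousLinearEquiv, ?_⟩
  ext v
  rfl

/-- A `C¹` bijection of a finite-dimensional space whose derivative is injective at every point
has a `C¹` inverse. -/
theorem contDiff_one_inverse [FiniteDimensional ℝ E] {F G : E → E}
    (hl : Function.LeftInverse G F) (hr : Function.RightInverse G F) (hF : ContDiff ℝ 1 F)
    (hker : ∀ x v, fderiv ℝ F x v = 0 → v = 0) : ContDiff ℝ 1 G := by
  have : CompleteSpace E := FiniteDimensional.complete ℝ E
  choose e he using fun x => exists_equiv_of_ker_trivial (fderiv ℝ F x) (hker x)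
  -- Invertible strict derivatives make `F` locally open, hence a homeomorphism, before smoothness
  -- of the inverse is addressed.
  have hopen : IsOpenMap F := by
    rw [isOpenMap_iff_nhds_le]
    intro x
    have h1 : HasStrictFDerivAt F (e x : E →L[ℝ] E) x := by
      rw [he x]
      exact hF.contDiffAt.hasStrictFDerivAt one_ne_zero
    exact h1.map_nhds_eq_of_equiv.ge
  let Φ : E ≃ₜ E := Equiv.toHomeomorphOfContinuousOpen ⟨F, G, hl, hr⟩ hF.continuous hopen
  have hd : ∀ a, HasFDerivAt Φ (e a : E →L[ℝ] E) a := by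
    intro a
    rw [he a]
    exact (hF.differentiable one_ne_zero a).hasFDerivAt
  exact Homeomorph.contDiff_symm Φ hd hF

theorem norm_fderiv_le_of_forall_norm_sub_le {g : E → E} {C : ℝ} (hC : 0 ≤ C)
    (hg : ∀ y y', ‖g y - g y'‖ ≤ C * ‖y - y'‖) (x : E) : ‖fderiv ℝ g x‖ ≤ C :=
  norm_fderiv_le_of_lip' ℝ hC (Filter.Eventually.of_forall fun y => hg y x)

end Calculus

/-! ### Cocycle property of the transition matrix. -/

section Transition

variable {A : ℕ → E →L[ℝ] E}

theorem transition_self (n : ℕ) : transition A n n = ContinuousLinearMap.id ℝ E := by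
  simp [transition, forward]

theorem comp_backward_succ (hA : ∀ k, (A k).IsInvertible) (k i : ℕ) :
    (A k).comp (backward A k (i + 1)) = backward A (k + 1) i := by
  induction i with
  | zero => simp [backward, (hA k).self_comp_inverse]
  | succ i ih =>
    rw [backward, ← ContinuousLinearMap.comp_assoc, ih, backward]
    congr 3
    ring

theorem transition_succ (hA : ∀ k, (A k).IsInvertible) (k n : ℕ) :
    transition A (k + 1) n = (A k).comp (transition A k n) := by
  rcases le_or_gt n k with h | h
  · obtain ⟨i, rfl⟩ := Nat.exists_eq_add_of_le h
    have h1 : n + i + 1 - n = i + 1 := by omega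
    simp [transition, h1, forward, show n ≤ n + i + 1 by omega]
  · obtain ⟨i, rfl⟩ := Nat.exists_eq_add_of_lt h
    have h2 : k + i + 1 - k = i + 1 := by omega
    have h3 : k + i + 1 - (k + 1) = i := by omega
    have h4 : ¬ k + i + 1 ≤ k := by omega
    rw [show transition A k (k + i + 1) = backward A k (i + 1) by simp [transition, h4, h2],
      comp_backward_succ hA]
    rcases Nat.eq_zero_or_pos i with rfl | hi
    · simp [transition, backward, forward]
    · simp [transition, h3, show ¬ i = 0 by omega]

/-- A solution of the linear system is determined by its value at any one time. -/
theorem IsLinearSolution.eq_of_eq_at (hA : ∀ k, (A k).IsInvertible) {x x' : ℕ → E}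
    (hx : IsLinearSolution A x) (hx' : IsLinearSolution A x') {m : ℕ} (hm : x m = x' m) :
    x = x' := by
  have hinj : ∀ k, Function.Injective (A k) := fun k => (hA k).injective
  have h0 : ∀ m, x m = x' m → x 0 = x' 0 := by
    intro m
    induction m with
    | zero => exact id
    | succ m ih =>
      intro h
      rw [hx, hx'] at h
      exact ih (hinj m h)
  funext k
  induction k with
  | zero => exact h0 m hm
  | succ k ih => rw [hx, hx', ih]

theorem isLinearSolution_transition (hA : ∀ k, (A k).IsInvertible) (n : ℕ) (ξ : E) :
    IsLinearSolution A fun k => transition A k n ξ := by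
  intro k
  simp [transition_succ hA]

theorem IsLinearSolution.eq_transition (hA : ∀ k, (A k).IsInvertible) {x : ℕ → E}
    (hx : IsLinearSolution A x) (k m : ℕ) : x k = transition A k m (x m) := by
  have := hx.eq_of_eq_at hA (isLinearSolution_transition hA m (x m)) (m := m)
    (by simp [transition_self])
  exact congrFun this k

theorem transition_transition (hA : ∀ k, (A k).IsInvertible) (k n m : ℕ) (ξ : E) :
    transition A k n (transition A n m ξ) = transition A k m ξ :=
  ((isLinearSolution_transition hA m ξ).eq_transition hA k n).symm

theorem transition_comp (hA : ∀ k, (A k).IsInvertible) (k n m : ℕ) :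
    (transition A k n).comp (transition A n m) = transition A k m := by
  ext ξ
  exact transition_transition hA k n m ξ

end Transition

/-! ### Green's operator and its sums. -/

section Green

variable {A P Q : ℕ → E →L[ℝ] E}

/-- Both branches propagate by `A k`; crossing the diagonal switches from `-ΦQ` to `ΦP`, a jump of
`P + Q = I`. -/
theorem green_succ (hA : ∀ k, (A k).IsInvertible)
    (hPQ : ∀ n, P n + Q n = ContinuousLinearMap.id ℝ E) (k n : ℕ) (v : E) :
    green A P Q (k + 1) n v = A k (green A P Q k n v) + if n = k + 1 then v else 0 := by
  rcases lt_trichotomy n (k + 1) with h | rfl | h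
  · simp [green, h.le, Nat.lt_succ_iff.1 h, h.ne, transition_succ hA]
  · have h1 : A k (transition A k (k + 1) (Q (k + 1) v)) = Q (k + 1) v := by
      rw [← ContinuousLinearMap.comp_apply, ← transition_succ hA, transition_self]
      rfl
    have h2 : P (k + 1) v + Q (k + 1) v = v := by
      rw [← add_apply, hPQ]
      rfl
    simp only [green, le_refl, if_true, transition_self, ContinuousLinearMap.id_comp,
      if_neg (show ¬ k + 1 ≤ k by omega), neg_apply, map_neg,
      ContinuousLinearMap.comp_apply, h1]
    nth_rewrite 3 [← h2]
    abel
  · simp [green, show ¬ n ≤ k + 1 by omega, show ¬ n ≤ k by omega, h.ne', transition_succ hA]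

/-- The unit jump selects the single term `j = k`. Convergence at one time thus passes to the next,
with no new estimate. -/
theorem hasSum_green_succ (hA : ∀ k, (A k).IsInvertible)
    (hPQ : ∀ n, P n + Q n = ContinuousLinearMap.id ℝ E) {k : ℕ} {g : ℕ → E} {s : E}
    (hs : HasSum (fun j => green A P Q k (j + 1) (g j)) s) :
    HasSum (fun j => green A P Q (k + 1) (j + 1) (g j)) (A k s + g k) := by
  have h1 : HasSum (fun j => if j = k then g k else 0) (g k) := hasSum_ite_eq k (g k)
  have h2 := ((A k).hasSum hs).add h1
  refine h2.congr_fun fun j => ?_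
  rw [green_succ hA hPQ]
  by_cases hj : j = k
  · subst hj; simp
  · simp [hj]

theorem GreenSumLE.summable_apply [CompleteSpace E] {a : ℕ → ℝ} {c : ℝ}
    (ha : GreenSumLE A P Q a c) {g : ℕ → E} (hg : ∀ j, ‖g j‖ ≤ a j) (k : ℕ) :
    Summable fun j => green A P Q k (j + 1) (g j) :=
  Summable.of_norm_bounded (ha k).1 fun j =>
    (ContinuousLinearMap.le_opNorm _ _).trans
      (mul_le_mul_of_nonneg_left (hg j) (norm_nonneg _))

theorem GreenSumLE.norm_le_of_hasSum {a : ℕ → ℝ} {c : ℝ}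
    (ha : GreenSumLE A P Q a c) {g : ℕ → E} (hg : ∀ j, ‖g j‖ ≤ a j) {k : ℕ} {s : E}
    (hs : HasSum (fun j => green A P Q k (j + 1) (g j)) s) : ‖s‖ ≤ c := by
  rw [← hs.tsum_eq]
  refine (tsum_of_norm_bounded (ha k).1.hasSum fun j => ?_).trans (ha k).2
  exact (ContinuousLinearMap.le_opNorm _ _).trans
    (mul_le_mul_of_nonneg_left (hg j) (norm_nonneg _))

theorem GreenSumLE.mul_const {a : ℕ → ℝ} {c : ℝ}
    (ha : GreenSumLE A P Q a c) {C : ℝ} (hC : 0 ≤ C) :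
    GreenSumLE A P Q (fun j => a j * C) (c * C) := by
  intro k
  simp only [← mul_assoc]
  refine ⟨(ha k).1.mul_right C, ?_⟩
  rw [tsum_mul_right]
  exact mul_le_mul_of_nonneg_right (ha k).2 hC

theorem GreenSumLE.nonneg {a : ℕ → ℝ} {c : ℝ}
    (ha : GreenSumLE A P Q a c) (h0 : ∀ j, 0 ≤ a j) : 0 ≤ c :=
  (tsum_nonneg fun j => mul_nonneg (norm_nonneg _) (h0 j)).trans (ha 0).2

/-- A bounded sequence which is dominated by a contractive Green sum of itself vanishes. -/
theorem eq_zero_of_bounded_of_hasSum_green {γ : ℕ → ℝ} {q : ℝ} (hγ : GreenSumLE A P Q γ q)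
    (hγ0 : ∀ j, 0 ≤ γ j) (hq : q < 1) {u g : ℕ → E} {C : ℝ} (hC : ∀ k, ‖u k‖ ≤ C)
    (hg : ∀ j, ‖g j‖ ≤ γ j * ‖u j‖)
    (hu : ∀ k, HasSum (fun j => green A P Q k (j + 1) (g j)) (u k)) (k : ℕ) : u k = 0 := by
  have hq0 : 0 ≤ q := hγ.nonneg hγ0
  have hC0 : 0 ≤ C := (norm_nonneg _).trans (hC 0)
  -- Each substitution of the bound into the Green sum gains a factor `q`.
  have hpow : ∀ n k, ‖u k‖ ≤ q ^ n * C := by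
    intro n
    induction n with
    | zero => simpa using hC
    | succ n ih =>
      intro k
      have := (hγ.mul_const (C := q ^ n * C) (by positivity)).norm_le_of_hasSum
        (fun j => (hg j).trans (mul_le_mul_of_nonneg_left (ih j) (hγ0 j))) (hu k)
      rw [pow_succ']
      linarith
  have hlim : Filter.Tendsto (fun n => q ^ n * C) Filter.atTop (nhds 0) := by
    simpa using (tendsto_pow_atTop_nhds_zero_of_lt_one hq0 hq).mul_const C
  exact norm_le_zero_iff.1 (ge_of_tendsto' hlim fun n => hpow n k)

end Green

/-! ### The perturbed flow from time `0`. -/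

section Flow

variable {A : ℕ → E →L[ℝ] E} {f : ℕ → E → E} {μ γ : ℕ → ℝ}

/-- The solution of the perturbed system that starts at time `0`. -/
def perturbedFlow (A : ℕ → E →L[ℝ] E) (f : ℕ → E → E) : ℕ → E → E
  | 0 => id
  | k + 1 => fun u => A k (perturbedFlow A f k u) + f k (perturbedFlow A f k u)

theorem isSolution_perturbedFlow (u : E) : IsSolution A f fun k => perturbedFlow A f k u :=
  fun _ => rfl

theorem IsSolution.eq_perturbedFlow {y : ℕ → E} (hy : IsSolution A f y) (k : ℕ) :
    y k = perturbedFlow A f k (y 0) := by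
  induction k with
  | zero => rfl
  | succ k ih => rw [hy, ih, perturbedFlow]

theorem norm_inverse_mul_lt_one (hf : LipschitzAndBounded f μ γ) (hback : BackwardContinuable A γ)
    (k : ℕ) : γ k * ‖(A k).inverse‖ < 1 := by
  have := hback k
  rwa [norm_smul, Real.norm_of_nonneg (hf.2.1 k)] at this

/-- A Lipschitz perturbation with constant below `‖A⁻¹‖⁻¹` keeps an invertible linear map a
homeomorphism. -/
theorem bijective_perturbed_step [CompleteSpace E] (hA : ∀ k, (A k).IsInvertible)
    (hf : LipschitzAndBounded f μ γ) (hback : BackwardContinuable A γ) (k : ℕ) :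
    Function.Bijective fun u => A k u + f k u := by
  obtain ⟨e, he⟩ := hA k
  obtain ⟨c, hc⟩ : ∃ c : NNReal, (c : ℝ) = γ k := ⟨⟨γ k, hf.2.1 k⟩, rfl⟩
  have happ : ApproximatesLinearOn (fun u => A k u + f k u) (e : E →L[ℝ] E) Set.univ c := by
    intro x _ y _
    have : A k x + f k x - (A k y + f k y) - (e : E →L[ℝ] E) (x - y) = f k x - f k y := by
      rw [he, map_sub]; abel
    rw [this, hc]
    exact hf.2.2.1 k x y
  -- On the trivial space the inverse has norm `0` and `0⁻¹ = 0`, so the strict bound needs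
  -- nontriviality.
  have hc' : Subsingleton E ∨ c < ‖(e.symm : E →L[ℝ] E)‖₊⁻¹ := by
    rcases subsingleton_or_nontrivial E with h | h
    · exact Or.inl h
    · right
      have hpos : 0 < ‖(e.symm : E →L[ℝ] E)‖ := e.norm_symm_pos
      rw [← NNReal.coe_lt_coe, NNReal.coe_inv, coe_nnnorm, hc, ← one_div,
        lt_div_iff₀ hpos]
      have := norm_inverse_mul_lt_one hf hback k
      rwa [← he, ContinuousLinearMap.inverse_equiv] at this
  exact (happ.toHomeomorph _ hc').bijective

theorem perturbedFlow_bijective [CompleteSpace E] (hA : ∀ k, (A k).IsInvertible)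
    (hf : LipschitzAndBounded f μ γ) (hback : BackwardContinuable A γ) (k : ℕ) :
    Function.Bijective (perturbedFlow A f k) := by
  induction k with
  | zero => exact Function.bijective_id
  | succ k ih => exact (bijective_perturbed_step hA hf hback k).comp ih

theorem perturbedFlow_contDiff (hsmooth : SmoothPerturbation f 1) (k : ℕ) :
    ContDiff ℝ 1 (perturbedFlow A f k) := by
  induction k with
  | zero => exact contDiff_id
  | succ k ih =>
    have h1 : ContDiff ℝ 1 (f k) := by simpa using (hsmooth k).1
    exact ((A k).contDiff.comp ih).add (h1.comp ih)

theorem fderiv_perturbedFlow_succ (hsmooth : SmoothPerturbation f 1) (k : ℕ) (u v : E) :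
    fderiv ℝ (perturbedFlow A f (k + 1)) u v = A k (fderiv ℝ (perturbedFlow A f k) u v) +
      fderiv ℝ (f k) (perturbedFlow A f k u) (fderiv ℝ (perturbedFlow A f k) u v) := by
  have h1 : ContDiff ℝ 1 (f k) := by simpa using (hsmooth k).1
  have h2 := ((perturbedFlow_contDiff (A := A) hsmooth k).differentiable one_ne_zero u).hasFDerivAt
  have h3 := (h1.differentiable one_ne_zero (perturbedFlow A f k u)).hasFDerivAt
  have h4 := ((A k).hasFDerivAt.comp u h2).add (h3.comp u h2)
  have h5 : fderiv ℝ (perturbedFlow A f (k + 1)) u = _ := h4.fderiv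
  rw [h5]
  rfl

theorem fderiv_perturbedFlow_ker (hA : ∀ k, (A k).IsInvertible)
    (hf : LipschitzAndBounded f μ γ) (hback : BackwardContinuable A γ)
    (hsmooth : SmoothPerturbation f 1) (k : ℕ) (u v : E)
    (hv : fderiv ℝ (perturbedFlow A f k) u v = 0) : v = 0 := by
  induction k with
  | zero => simpa [perturbedFlow] using hv
  | succ k ih =>
    rw [fderiv_perturbedFlow_succ hsmooth] at hv
    apply ih
    set w := fderiv ℝ (perturbedFlow A f k) u v
    set B := fderiv ℝ (f k) (perturbedFlow A f k u)
    have hB : ‖B‖ ≤ γ k := norm_fderiv_le_of_forall_norm_sub_le (hf.2.1 k) (hf.2.2.1 k) _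
    have h1 : w = -(A k).inverse (B w) := by
      rw [← map_neg, ← eq_neg_of_add_eq_zero_left hv, (hA k).inverse_apply_self]
    -- The factor is less than `1`, which forces `w = 0`.
    have h2 : ‖w‖ ≤ γ k * ‖(A k).inverse‖ * ‖w‖ := by
      calc ‖w‖ = ‖(A k).inverse (B w)‖ := (congrArg norm h1).trans (norm_neg _)
        _ ≤ ‖(A k).inverse‖ * (‖B‖ * ‖w‖) := (ContinuousLinearMap.le_opNorm _ _).trans
            (mul_le_mul_of_nonneg_left (ContinuousLinearMap.le_opNorm _ _) (norm_nonneg _))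
        _ ≤ ‖(A k).inverse‖ * (γ k * ‖w‖) := by gcongr
        _ = _ := by ring
    have h3 := norm_inverse_mul_lt_one hf hback k
    by_contra hw
    have : 0 < ‖w‖ := norm_pos_iff.2 hw
    nlinarith

theorem norm_perturbedFlow_sub_le (hf : LipschitzAndBounded f μ γ) (k : ℕ) (u v : E) :
    ‖perturbedFlow A f k u - perturbedFlow A f k v‖ ≤
      (∏ p ∈ Finset.range k, (‖A p‖ + γ p)) * ‖u - v‖ := by
  induction k with
  | zero => simp [perturbedFlow]
  | succ k ih =>
    have h0 := hf.2.1 k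
    set a := perturbedFlow A f k u
    set b := perturbedFlow A f k v
    calc ‖perturbedFlow A f (k + 1) u - perturbedFlow A f (k + 1) v‖
        = ‖A k (a - b) + (f k a - f k b)‖ := by
          congr 1; simp only [perturbedFlow, map_sub, a, b]; abel
      _ ≤ ‖A k‖ * ‖a - b‖ + γ k * ‖a - b‖ := (norm_add_le _ _).trans
          (add_le_add ((A k).le_opNorm _) (hf.2.2.1 k a b))
      _ = (‖A k‖ + γ k) * ‖a - b‖ := by ring
      _ ≤ (‖A k‖ + γ k) * ((∏ p ∈ Finset.range k, (‖A p‖ + γ p)) * ‖u - v‖) := by gcongr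
      _ = _ := by rw [Finset.prod_range_succ]; ring

end Flow

/-! ### Palmer's bounded fixed points. -/

section FixedPoint

variable {A P Q : ℕ → E →L[ℝ] E} {f : ℕ → E → E} {D h μ γ : ℕ → ℝ} {p q : ℝ}

theorem exists_isPalmerFixedPoint [CompleteSpace E] (hf : LipschitzAndBounded f μ γ)
    (hμ : GreenSumLE A P Q μ p) (hγ : GreenSumLE A P Q γ q) (hq : q < 1) (m : ℕ) (ξ : E) :
    ∃ z, IsPalmerFixedPoint A P Q f m ξ z := by
  have hq0 : 0 ≤ q := hγ.nonneg hf.2.1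
  have hs : ∀ (z : ℕ → E) k,
      HasSum (fun j => green A P Q k (j + 1) (f j (transition A j m ξ + z j)))
        (∑' j, green A P Q k (j + 1) (f j (transition A j m ξ + z j))) := fun z k =>
    (hμ.summable_apply (fun j => hf.2.2.2 j _) k).hasSum
  let T : BoundedContinuousFunction ℕ E → BoundedContinuousFunction ℕ E := fun z =>
    BoundedContinuousFunction.ofNormedAddCommGroupDiscrete
      (fun k => ∑' j, green A P Q k (j + 1) (f j (transition A j m ξ + z j))) p
      fun k => hμ.norm_le_of_hasSum (fun j => hf.2.2.2 j _) (hs z k)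
  have hT : ContractingWith ⟨q, hq0⟩ T := by
    refine ⟨hq, LipschitzWith.of_dist_le_mul fun z w => ?_⟩
    refine (BoundedContinuousFunction.dist_le (mul_nonneg hq0 dist_nonneg)).2 fun k => ?_
    rw [dist_eq_norm]
    have h1 := (hs z k).sub (hs w k)
    simp only [← map_sub] at h1
    refine (hγ.mul_const (C := dist z w) dist_nonneg).norm_le_of_hasSum (fun j => ?_) h1
    refine (hf.2.2.1 j _ _).trans (mul_le_mul_of_nonneg_left ?_ (hf.2.1 j))
    rw [add_sub_add_left_eq_sub, ← dist_eq_norm]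
    exact BoundedContinuousFunction.dist_coe_le_dist j
  obtain ⟨z, hz⟩ : ∃ z, T z = z := ⟨_, hT.fixedPoint_isFixedPt⟩
  refine ⟨z, ⟨_, z.norm_coe_le_norm⟩, fun k => ?_⟩
  have h1 : z k = _ := (DFunLike.congr_fun hz k).symm
  have h2 := hs z k
  rw [h1]
  exact h2

theorem IsPalmerFixedPoint.unique (hf : LipschitzAndBounded f μ γ)
    (hγ : GreenSumLE A P Q γ q) (hq : q < 1) {m : ℕ} {ξ : E} {z w : ℕ → E}
    (hz : IsPalmerFixedPoint A P Q f m ξ z) (hw : IsPalmerFixedPoint A P Q f m ξ w) :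
    z = w := by
  obtain ⟨⟨C, hC⟩, hz⟩ := hz
  obtain ⟨⟨C', hC'⟩, hw⟩ := hw
  funext k
  rw [← sub_eq_zero]
  refine eq_zero_of_bounded_of_hasSum_green hγ hf.2.1 hq (u := fun k => z k - w k)
    (g := fun j => f j (transition A j m ξ + z j) - f j (transition A j m ξ + w j))
    (C := C + C') (fun k => (norm_sub_le _ _).trans (add_le_add (hC k) (hC' k)))
    (fun j => ?_) (fun k => ?_) k
  · simpa using hf.2.2.1 j (transition A j m ξ + z j) (transition A j m ξ + w j)
  · simpa using (hz k).sub (hw k)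

/-- Only the linear orbit enters the equation, not the time at which it is anchored; this allows
anchoring at time `0`. -/
theorem isPalmerFixedPoint_transition (hA : ∀ k, (A k).IsInvertible) {m n : ℕ} {ξ : E}
    {z : ℕ → E} : IsPalmerFixedPoint A P Q f n (transition A n m ξ) z ↔
      IsPalmerFixedPoint A P Q f m ξ z := by
  simp only [IsPalmerFixedPoint, transition_transition hA]

theorem IsPalmerFixedPoint.norm_le (hf : LipschitzAndBounded f μ γ)
    (hμ : GreenSumLE A P Q μ p) {m : ℕ} {ξ : E} {z : ℕ → E}
    (hz : IsPalmerFixedPoint A P Q f m ξ z) (k : ℕ) : ‖z k‖ ≤ p :=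
  hμ.norm_le_of_hasSum (fun j => hf.2.2.2 j _) (hz.2 k)

theorem IsPalmerFixedPoint.isSolution (hA : ∀ k, (A k).IsInvertible)
    (hPQ : ∀ n, P n + Q n = ContinuousLinearMap.id ℝ E) {m : ℕ} {ξ : E} {z : ℕ → E}
    (hz : IsPalmerFixedPoint A P Q f m ξ z) :
    IsSolution A f fun k => transition A k m ξ + z k := by
  intro k
  have h1 := (hz.2 (k + 1)).unique (hasSum_green_succ hA hPQ (hz.2 k))
  simp only [h1, transition_succ hA, ContinuousLinearMap.comp_apply, map_add, add_assoc]

end FixedPoint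

/-! ### Differentiability of the inverse map at time `0` and injectivity of its derivative. -/

section Derivative

variable {A P Q : ℕ → E →L[ℝ] E} {f : ℕ → E → E} {D h μ γ : ℕ → ℝ} {p q : ℝ}

theorem IsNonuniformDichotomy.norm_green_zero_le (hd : IsNonuniformDichotomy A P Q D h) (j : ℕ) :
    ‖green A P Q 0 (j + 1)‖ ≤ D (j + 1) * h (j + 1) := by
  have := hd.unstable 0 (j + 1) (Nat.zero_le _)
  rw [hd.h_zero, div_one] at this
  simpa [green] using this

theorem green_eq_transition_comp (hA : ∀ k, (A k).IsInvertible) {k n : ℕ} (hkn : k < n) :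
    green A P Q k n = (transition A k 0).comp (green A P Q 0 n) := by
  rw [green, green, if_neg (by omega), if_neg (by omega), ContinuousLinearMap.comp_neg,
    ← ContinuousLinearMap.comp_assoc, transition_comp hA]

theorem norm_transition_zero_le (hγ0 : ∀ j, 0 ≤ γ j) (k : ℕ) :
    ‖transition A k 0‖ ≤ ∏ p ∈ Finset.range k, (‖A p‖ + γ p) := by
  have : transition A k 0 = forward A 0 k := by simp [transition]
  rw [this]
  induction k with
  | zero => simpa [forward] using ContinuousLinearMap.norm_id_le
  | succ k ih =>
    rw [forward, Finset.prod_range_succ, mul_comm]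
    refine (ContinuousLinearMap.opNorm_comp_le _ _).trans ?_
    rw [zero_add]
    have h1 := hγ0 k
    have h2 := ih (by simp [transition])
    gcongr
    linarith

/-- A solution of a linear perturbation of the linear system which satisfies the homogeneous
integral equation at time `0` vanishes, provided that the a priori growth of its solutions is
compensated by the decay of Green's operator. -/
theorem eq_zero_of_hasSum_green_zero [CompleteSpace E] (hA : ∀ k, (A k).IsInvertible)
    (hd : IsNonuniformDichotomy A P Q D h) (hγ0 : ∀ j, 0 ≤ γ j) (hγ : GreenSumLE A P Q γ q)
    (hq : q < 1) (hw : WeightedSummable A D h γ) {u g : ℕ → E}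
    (hg : ∀ j, ‖g j‖ ≤ γ j * ‖u j‖) (hu : ∀ j, u (j + 1) = A j (u j) + g j)
    (h0 : HasSum (fun j => green A P Q 0 (j + 1) (g j)) (u 0)) : u 0 = 0 := by
  have hq0 : 0 ≤ q := hγ.nonneg hγ0
  have hsum : ∀ k, HasSum (fun j => green A P Q k (j + 1) (g j)) (u k) := by
    intro k
    induction k with
    | zero => exact h0
    | succ k ih =>
      rw [hu]
      exact hasSum_green_succ hA hd.complementary ih
  let w : ℕ → ℝ := fun k => ∏ p ∈ Finset.range k, (‖A p‖ + γ p)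
  have hw0 : ∀ k, 0 ≤ w k := fun k =>
    Finset.prod_nonneg fun p _ => add_nonneg (norm_nonneg _) (hγ0 p)
  have hwsucc : ∀ k, w (k + 1) = w k * (‖A k‖ + γ k) := fun k => Finset.prod_range_succ _ _
  -- Growth from `k` to `i + k`, stated without dividing by `w k`.
  have hgrow : ∀ k i, w k * ‖u (i + k)‖ ≤ w (i + k) * ‖u k‖ := by
    intro k i
    induction i with
    | zero => simp
    | succ i ih =>
      have h1 : ‖u (i + k + 1)‖ ≤ (‖A (i + k)‖ + γ (i + k)) * ‖u (i + k)‖ := by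
        rw [hu, add_mul]
        exact (norm_add_le _ _).trans (add_le_add ((A _).le_opNorm _) (hg _))
      have h2 : 0 ≤ ‖A (i + k)‖ + γ (i + k) := add_nonneg (norm_nonneg _) (hγ0 _)
      rw [show i + 1 + k = i + k + 1 by ring, hwsucc]
      calc w k * ‖u (i + k + 1)‖ ≤ w k * ((‖A (i + k)‖ + γ (i + k)) * ‖u (i + k)‖) :=
            mul_le_mul_of_nonneg_left h1 (hw0 k)
        _ = (‖A (i + k)‖ + γ (i + k)) * (w k * ‖u (i + k)‖) := by ring
        _ ≤ (‖A (i + k)‖ + γ (i + k)) * (w (i + k) * ‖u k‖) := by gcongr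
        _ = _ := by ring
  let c : ℕ → ℝ := fun j => D (j + 1) * h (j + 1) * γ j * w j
  have hc : Summable c := by simpa [c, w] using hw 0
  -- For future indices Green's operator factors through time `0`. The cost `w k` of `Φ(k, 0)` is
  -- exactly what `hgrow` absorbs.
  have htail : ∀ k, ‖∑' i, green A P Q k (i + k + 1) (g (i + k))‖ ≤
      (∑' i, c (i + k)) * ‖u k‖ := by
    intro k
    rw [← tsum_mul_right]
    refine tsum_of_norm_bounded (((summable_nat_add_iff k).2 hc).mul_right _).hasSum fun i => ?_
    rw [green_eq_transition_comp hA (by omega), ContinuousLinearMap.comp_apply]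
    have hDh : 0 ≤ D (i + k + 1) * h (i + k + 1) := mul_nonneg (hd.D_nonneg _) (hd.h_pos _).le
    calc ‖transition A k 0 (green A P Q 0 (i + k + 1) (g (i + k)))‖
        ≤ ‖transition A k 0‖ * (‖green A P Q 0 (i + k + 1)‖ * ‖g (i + k)‖) :=
          (ContinuousLinearMap.le_opNorm _ _).trans
            (mul_le_mul_of_nonneg_left (ContinuousLinearMap.le_opNorm _ _) (norm_nonneg _))
      _ ≤ w k * ((D (i + k + 1) * h (i + k + 1)) * (γ (i + k) * ‖u (i + k)‖)) := by
          gcongr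
          · exact hw0 k
          · exact norm_transition_zero_le hγ0 k
          · exact hd.norm_green_zero_le _
          · exact hg _
      _ = (D (i + k + 1) * h (i + k + 1) * γ (i + k)) * (w k * ‖u (i + k)‖) := by ring
      _ ≤ (D (i + k + 1) * h (i + k + 1) * γ (i + k)) * (w (i + k) * ‖u k‖) :=
          mul_le_mul_of_nonneg_left (hgrow k i) (mul_nonneg hDh (hγ0 _))
      _ = c (i + k) * ‖u k‖ := by simp only [c]; ring
  -- The threshold `(1 - q) / 2` leaves room for absorption: the final bound is `(1 + q) / 2 * ‖u k‖
  -- ≤ q * C`, and `q ≤ (1 + q) / 2`.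
  obtain ⟨N, hN⟩ := Filter.eventually_atTop.1
    ((tendsto_sum_nat_add c).eventually (gt_mem_nhds (show 0 < (1 - q) / 2 by linarith)))
  let C : ℝ := ∑ j ∈ Finset.range N, ‖u j‖
  have hC0 : 0 ≤ C := Finset.sum_nonneg fun j _ => norm_nonneg _
  have hC : ∀ k, ‖u k‖ ≤ C := by
    intro k
    induction k using Nat.strong_induction_on with
    | _ k ih =>
      rcases lt_or_ge k N with hk | hk
      · exact Finset.single_le_sum (f := fun j => ‖u j‖) (fun j _ => norm_nonneg _)
          (Finset.mem_range.2 hk)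
      · have hhead : ‖∑ j ∈ Finset.range k, green A P Q k (j + 1) (g j)‖ ≤ q * C := by
          calc ‖∑ j ∈ Finset.range k, green A P Q k (j + 1) (g j)‖
              ≤ ∑ j ∈ Finset.range k, ‖green A P Q k (j + 1)‖ * γ j * C := by
                refine norm_sum_le_of_le _ fun j hj => ?_
                rw [mul_assoc]
                refine (ContinuousLinearMap.le_opNorm _ _).trans
                  (mul_le_mul_of_nonneg_left ((hg j).trans ?_) (norm_nonneg _))
                exact mul_le_mul_of_nonneg_left (ih j (Finset.mem_range.1 hj)) (hγ0 j)
            _ = (∑ j ∈ Finset.range k, ‖green A P Q k (j + 1)‖ * γ j) * C := by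
                rw [Finset.sum_mul]
            _ ≤ q * C := by
                refine mul_le_mul_of_nonneg_right (le_trans ?_ (hγ k).2) hC0
                exact (hγ k).1.sum_le_tsum _ fun j _ => mul_nonneg (norm_nonneg _) (hγ0 j)
        have hsplit : u k = ∑ j ∈ Finset.range k, green A P Q k (j + 1) (g j) +
            ∑' i, green A P Q k (i + k + 1) (g (i + k)) := by
          rw [(hsum k).summable.sum_add_tsum_nat_add k, (hsum k).tsum_eq]
        have h1 : ‖u k‖ ≤ q * C + (1 - q) / 2 * ‖u k‖ := by
          calc ‖u k‖ ≤ _ := (congrArg norm hsplit).trans_le (norm_add_le _ _)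
            _ ≤ _ := add_le_add hhead ((htail k).trans
                (mul_le_mul_of_nonneg_right (hN k hk).le (norm_nonneg _)))
        nlinarith
  exact eq_zero_of_bounded_of_hasSum_green hγ hγ0 hq hC hg hsum 0

/-- Palmer's inverse map at time `0`. -/
noncomputable def palmerInverseZero (A P Q : ℕ → E →L[ℝ] E) (f : ℕ → E → E) (η : E) : E :=
  η - ∑' j, green A P Q 0 (j + 1) (f j (perturbedFlow A f j η))

theorem WeightedSummable.range (hw : WeightedSummable A D h γ) :
    Summable fun j =>
      D (j + 1) * h (j + 1) * (γ j * ∏ p ∈ Finset.range j, (‖A p‖ + γ p)) := by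
  simpa [mul_assoc] using hw 0

theorem contDiff_green_perturbedFlow (hsmooth : SmoothPerturbation f 1) (j : ℕ) :
    ContDiff ℝ 1 fun η => green A P Q 0 (j + 1) (f j (perturbedFlow A f j η)) := by
  have h1 : ContDiff ℝ 1 (f j) := by simpa using (hsmooth j).1
  exact (green A P Q 0 (j + 1)).contDiff.comp (h1.comp (perturbedFlow_contDiff hsmooth j))

theorem norm_fderiv_green_perturbedFlow_le (hd : IsNonuniformDichotomy A P Q D h)
    (hf : LipschitzAndBounded f μ γ) (j : ℕ) (η : E) :
    ‖fderiv ℝ (fun η => green A P Q 0 (j + 1) (f j (perturbedFlow A f j η))) η‖ ≤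
      D (j + 1) * h (j + 1) * (γ j * ∏ p ∈ Finset.range j, (‖A p‖ + γ p)) := by
  have hγ0 := hf.2.1 j
  have hDh : 0 ≤ D (j + 1) * h (j + 1) := mul_nonneg (hd.D_nonneg _) (hd.h_pos _).le
  have hprod : 0 ≤ ∏ p ∈ Finset.range j, (‖A p‖ + γ p) :=
    Finset.prod_nonneg fun p _ => add_nonneg (norm_nonneg _) (hf.2.1 p)
  refine norm_fderiv_le_of_forall_norm_sub_le (by positivity) (fun y y' => ?_) η
  rw [← map_sub]
  calc _ ≤ ‖green A P Q 0 (j + 1)‖ * ‖f j (perturbedFlow A f j y) - f j (perturbedFlow A f j y')‖ :=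
        ContinuousLinearMap.le_opNorm _ _
    _ ≤ (D (j + 1) * h (j + 1)) *
        (γ j * ((∏ p ∈ Finset.range j, (‖A p‖ + γ p)) * ‖y - y'‖)) := by
        gcongr
        · exact hd.norm_green_zero_le j
        · exact (hf.2.2.1 j _ _).trans
            (mul_le_mul_of_nonneg_left (norm_perturbedFlow_sub_le hf j y y') hγ0)
    _ = _ := by ring

theorem contDiff_palmerInverseZero [CompleteSpace E] (hd : IsNonuniformDichotomy A P Q D h)
    (hf : LipschitzAndBounded f μ γ) (hμ : GreenSumLE A P Q μ p)
    (hsmooth : SmoothPerturbation f 1) (hw : WeightedSummable A D h γ) :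
    ContDiff ℝ 1 (palmerInverseZero A P Q f) := by
  refine contDiff_id.sub ?_
  -- The values are dominated through `μ`, the first derivatives through the weighted series.
  let v : ℕ → ℕ → ℝ := fun n j => if n = 0 then ‖green A P Q 0 (j + 1)‖ * μ j else
    D (j + 1) * h (j + 1) * (γ j * ∏ p ∈ Finset.range j, (‖A p‖ + γ p))
  refine contDiff_tsum (N := 1) (v := v) (fun j => contDiff_green_perturbedFlow hsmooth j)
    (fun n _ => ?_) (fun n j η hn => ?_)
  · by_cases hn : n = 0
    · simpa [v, hn] using (hμ 0).1
    · simpa [v, hn] using hw.range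
  · have hn : n ≤ 1 := by exact_mod_cast hn
    interval_cases n
    · rw [norm_iteratedFDeriv_zero]
      exact (ContinuousLinearMap.le_opNorm _ _).trans
        (mul_le_mul_of_nonneg_left (hf.2.2.2 j _) (norm_nonneg _))
    · rw [norm_iteratedFDeriv_one]
      exact norm_fderiv_green_perturbedFlow_le hd hf j η

theorem fderiv_palmerInverseZero_ker [CompleteSpace E] (hA : ∀ k, (A k).IsInvertible)
    (hd : IsNonuniformDichotomy A P Q D h) (hf : LipschitzAndBounded f μ γ)
    (hμ : GreenSumLE A P Q μ p) (hγ : GreenSumLE A P Q γ q) (hq : q < 1)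
    (hsmooth : SmoothPerturbation f 1) (hw : WeightedSummable A D h γ) (η v : E)
    (hv : fderiv ℝ (palmerInverseZero A P Q f) η v = 0) : v = 0 := by
  let t : ℕ → E → E := fun j η => green A P Q 0 (j + 1) (f j (perturbedFlow A f j η))
  have hdiff : ∀ j, Differentiable ℝ (t j) := fun j =>
    (contDiff_green_perturbedFlow hsmooth j).differentiable one_ne_zero
  have hbound := norm_fderiv_green_perturbedFlow_le (A := A) (P := P) (Q := Q) hd hf
  have hG : HasFDerivAt (palmerInverseZero A P Q f)
      (ContinuousLinearMap.id ℝ E - ∑' j, fderiv ℝ (t j) η) η :=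
    (hasFDerivAt_id η).sub (hasFDerivAt_tsum hw.range (fun j x => (hdiff j x).hasFDerivAt)
      hbound (hμ.summable_apply (fun j => hf.2.2.2 j (perturbedFlow A f j η)) 0) η)
  -- Vanishing of the derivative `I - ∑ Dt_j` at `v` says that `v` is the sum of the `Dt_j v`.
  have hsum : HasSum (fun j => fderiv ℝ (t j) η v) v := by
    have h1 : Summable fun j => fderiv ℝ (t j) η :=
      Summable.of_norm_bounded hw.range fun j => hbound j η
    have h2 := (ContinuousLinearMap.apply ℝ E v).hasSum h1.hasSum
    rw [hG.fderiv, sub_apply, sub_eq_zero] at hv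
    have h3 : (ContinuousLinearMap.apply ℝ E v) (∑' j, fderiv ℝ (t j) η) = v := hv.symm
    rw [h3] at h2
    exact h2
  let u : ℕ → E := fun j => fderiv ℝ (perturbedFlow A f j) η v
  let g : ℕ → E := fun j => fderiv ℝ (f j) (perturbedFlow A f j η) (u j)
  have hu0 : u 0 = v := by simp [u, perturbedFlow]
  have hterm : ∀ j, fderiv ℝ (t j) η v = green A P Q 0 (j + 1) (g j) := by
    intro j
    have h1 : ContDiff ℝ 1 (f j) := by simpa using (hsmooth j).1
    have h2 := ((perturbedFlow_contDiff (A := A) hsmooth j).differentiable one_ne_zero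
      η).hasFDerivAt
    have h3 := (h1.differentiable one_ne_zero (perturbedFlow A f j η)).hasFDerivAt
    have h4 : HasFDerivAt (t j) _ η :=
      (green A P Q 0 (j + 1)).hasFDerivAt.comp η (h3.comp η h2)
    rw [h4.fderiv]
    rfl
  rw [← hu0]
  refine eq_zero_of_hasSum_green_zero hA hd hf.2.1 hγ hq hw (u := u) (g := g) (fun j => ?_)
    (fun j => fderiv_perturbedFlow_succ hsmooth j η v) ?_
  · exact ((fderiv ℝ (f j) _).le_opNorm _).trans (mul_le_mul_of_nonneg_right
      (norm_fderiv_le_of_forall_norm_sub_le (hf.2.1 j) (hf.2.2.1 j) _) (norm_nonneg _))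
  · rw [hu0]
    simpa only [hterm] using hsum

end Derivative

end DiscretePalmer

/-! ### Assembly of the equivalence. -/

open DiscretePalmer in
theorem theorem3p2 {E : Type*} [NormedAddCommGroup E] [NormedSpace ℝ E] [FiniteDimensional ℝ E]
    (A P Q : ℕ → E →L[ℝ] E) (f : ℕ → E → E) (D h μ γ : ℕ → ℝ) (p q : ℝ)
    (hA : DiscretePalmer.InvertibleBounded A)
    (hdich : DiscretePalmer.IsNonuniformDichotomy A P Q D h)
    (hf : DiscretePalmer.LipschitzAndBounded f μ γ)
    (hμ : DiscretePalmer.GreenSumLE A P Q μ p)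
    (hγ : DiscretePalmer.GreenSumLE A P Q γ q) (hq : q < 1)
    (hback : DiscretePalmer.BackwardContinuable A γ)
    (hsmooth : DiscretePalmer.SmoothPerturbation f 1)
    (hweight : DiscretePalmer.WeightedSummable A D h γ) :
    ∃ H G : ℕ → E → E,
      DiscretePalmer.IsTopologicalEquivalenceOfClass 1 A f H G ∧
      DiscretePalmer.IsPalmerMap A P Q f H ∧
      DiscretePalmer.IsPalmerInverse A P Q f G := by
  have : CompleteSpace E := FiniteDimensional.complete ℝ E
  have hA := hA.1
  have hPQ := hdich.complementary
  choose z hz using exists_isPalmerFixedPoint hf hμ hγ hq 0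
  set G0 := palmerInverseZero A P Q f with hG0
  let H0 : E → E := fun ξ => ξ + z ξ 0
  let Y := perturbedFlow A f
  have hYbij : ∀ k, Function.Bijective (Y k) := perturbedFlow_bijective hA hf hback
  let X : ℕ → E → E := fun k => Function.invFun (Y k)
  have hXY : ∀ k, Function.LeftInverse (X k) (Y k) := fun k =>
    Function.leftInverse_invFun (hYbij k).1
  have hYX : ∀ k, Function.RightInverse (X k) (Y k) := fun k =>
    Function.rightInverse_invFun (hYbij k).2
  have hYC : ∀ k, ContDiff ℝ 1 (Y k) := perturbedFlow_contDiff hsmooth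
  have hXC : ∀ k, ContDiff ℝ 1 (X k) := fun k => contDiff_one_inverse (hXY k) (hYX k) (hYC k)
    (fderiv_perturbedFlow_ker hA hf hback hsmooth k)
  have hsolY : ∀ η, IsSolution A f fun k => Y k η := isSolution_perturbedFlow
  -- The value of Palmer's inverse along a perturbed solution.
  have hsumG : ∀ η k, HasSum (fun j => green A P Q k (j + 1) (f j (Y j η)))
      (Y k η - transition A k 0 (G0 η)) := by
    intro η k
    induction k with
    | zero =>
      have h1 : Y 0 η - transition A 0 0 (G0 η) =
          ∑' j, green A P Q 0 (j + 1) (f j (Y j η)) := by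
        simp [transition_self, hG0, palmerInverseZero, Y, perturbedFlow]
      rw [h1]
      exact (hμ.summable_apply (fun j => hf.2.2.2 j _) 0).hasSum
    | succ k ih =>
      have h1 : Y (k + 1) η - transition A (k + 1) 0 (G0 η) =
          A k (Y k η - transition A k 0 (G0 η)) + f k (Y k η) := by
        rw [transition_succ hA, show Y (k + 1) η = _ from hsolY η k, map_sub,
          ContinuousLinearMap.comp_apply]
        abel
      rw [h1]
      exact hasSum_green_succ hA hPQ ih
  -- Palmer's map along a linear solution.
  have hYH : ∀ ξ k, Y k (H0 ξ) = transition A k 0 ξ + z ξ k := by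
    intro ξ k
    have h1 := ((hz ξ).isSolution hA hPQ).eq_perturbedFlow k
    simpa [transition_self, H0, Y] using h1.symm
  -- The perturbed orbit minus the linear orbit of `G0 η` is bounded by `p` and is a fixed point,
  -- hence equals `z (G0 η)`.
  have hHG : ∀ η, H0 (G0 η) = η := by
    intro η
    have h1 : IsPalmerFixedPoint A P Q f 0 (G0 η) fun k => Y k η - transition A k 0 (G0 η) := by
      refine ⟨⟨p, fun k => hμ.norm_le_of_hasSum (fun j => hf.2.2.2 j _) (hsumG η k)⟩,
        fun k => ?_⟩
      simpa using hsumG η k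
    have h2 := (hz (G0 η)).unique hf hγ hq h1
    simp [H0, h2, transition_self, Y, perturbedFlow]
  have hGH : ∀ ξ, G0 (H0 ξ) = ξ := by
    intro ξ
    have h1 := hsumG (H0 ξ) 0
    simp only [hYH] at h1
    have h2 := h1.unique ((hz ξ).2 0)
    have h3 : ξ - G0 (H0 ξ) = 0 := by simpa [transition_self, add_sub_right_comm] using h2
    exact (sub_eq_zero.1 h3).symm
  have hG0C : ContDiff ℝ 1 G0 := contDiff_palmerInverseZero hdich hf hμ hsmooth hweight
  -- `G0` is the map with a computable derivative; `H0` inherits its smoothness as the inverse.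
  have hH0C : ContDiff ℝ 1 H0 := contDiff_one_inverse hHG hGH hG0C
    (fderiv_palmerInverseZero_ker hA hdich hf hμ hγ hq hsmooth hweight)
  -- Pull back linearly to time `0`, apply `H0`, then push forward by the perturbed flow; this makes
  -- `H` carry orbits to orbits by construction.
  let H : ℕ → E → E := fun k ξ => Y k (H0 (transition A 0 k ξ))
  let G : ℕ → E → E := fun k η => transition A k 0 (G0 (X k η))
  have hH : ∀ k ξ, H k ξ = ξ + z (transition A 0 k ξ) k := by
    intro k ξ
    simp [H, hYH, transition_transition hA, transition_self]
  have hG : ∀ k η, HasSum (fun j => green A P Q k (j + 1) (f j (Y j (X k η)))) (η - G k η) := by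
    intro k η
    have h1 := hsumG (X k η) k
    rwa [hYX k η] at h1
  have hHC : ∀ k, ContDiff ℝ 1 (H k) := fun k =>
    (hYC k).comp (hH0C.comp (transition A 0 k).contDiff)
  have hGC : ∀ k, ContDiff ℝ 1 (G k) := fun k =>
    (transition A k 0).contDiff.comp (hG0C.comp (hXC k))
  refine ⟨H, G, ⟨⟨?_, ?_, fun k => (hHC k).continuous, fun k => (hGC k).continuous, ?_, ?_,
    ⟨p, ?_⟩, ⟨p, ?_⟩⟩, ?_, ?_⟩, ?_, ?_⟩
  · intro k ξ
    simp only [H, G, hXY k _, hGH, transition_transition hA, transition_self]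
    rfl
  · intro k η
    simp only [H, G, transition_transition hA, transition_self, ContinuousLinearMap.id_apply,
      hHG, hYX k _]
  · intro x hx
    have h1 : ∀ k, H k (x k) = Y k (H0 (x 0)) := by
      intro k
      simp only [H, ← hx.eq_transition hA 0 k]
    simp only [h1]
    exact hsolY _
  · intro y hy
    have h1 : ∀ k, G k (y k) = transition A k 0 (G0 (y 0)) := by
      intro k
      simp only [G, hy.eq_perturbedFlow k]
      rw [hXY k (y 0)]
    simp only [h1]
    exact isLinearSolution_transition hA 0 _
  · intro k ξ
    rw [hH, add_sub_cancel_left]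
    exact (hz _).norm_le hf hμ k
  · intro k η
    rw [norm_sub_rev]
    exact hμ.norm_le_of_hasSum (fun j => hf.2.2.2 j _) (hG k η)
  · simpa using hHC
  · simpa using hGC
  · intro m ξ
    have h1 : IsPalmerFixedPoint A P Q f m ξ (z (transition A 0 m ξ)) :=
      (isPalmerFixedPoint_transition hA).1 (hz _)
    exact ⟨_, h1, fun z' hz' => hz'.unique hf hγ hq h1, hH m ξ⟩
  · intro m η
    refine ⟨fun k => Y k (X m η), ⟨hsolY _, hYX m η⟩, ?_, hG m η⟩
    rintro y' ⟨hy', rfl⟩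
    funext k
    rw [hy'.eq_perturbedFlow k, hy'.eq_perturbedFlow m]
    exact congrArg (Y k) (hXY m (y' 0)).symm
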